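/- Let $L$ be a many-sorted language of continuous logic: every sort $s$ has a diameter bound, function and relation symbols have moduli of uniform continuity, and relation symbols take values in prescribed compact intervals. In an $L$-structure, every sort is a nonempty complete metric space satisfying its diameter bound. Formulae are built from the atomic formulae (relation symbols, and the metrics of the sorts, applied to terms) by continuous connectives $\mathbb R^k\to\mathbb R$ and the quantifiers $\sup$ and $\inf$ over sorts. Let $T$ be an $L$-theory, that is, a set of sentences, where $M\models T$ means that $\varphi^M=0$ for all $\varphi\in T$. Let $\vec x$ be a finite sequence of variables, possibly of different sorts. The space of $T$-formulae over $\vec x$ is the separated completion of the set of $L$-formulae $\varphi(\vec x)$ under the pseudometric $d_{T,\vec x}(\varphi,\psi)=\sup\{|\varphi(\vec a)^M-\psi(\vec a)^M| : M\models T,\ \vec a\in M^{\vec x}\}$. For a $T$-formula $\theta$, a model $M\models T$ and $\vec a\in M^{\vec x}$, the value $\theta^M(\vec a)\in\mathbb R$ is defined by continuous extension from formulae, and $\operatorname{tp}^M(\vec a)$ is the functional $\theta\mapsto\theta^M(\vec a)$. Let $\mathbf S_{\vec x}(T)$ be the set of all types $\operatorname{tp}^M(\vec a)$ with $M\models T$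 and $\vec a\in M^{\vec x}$, with the logic topology (pointwise convergence on $T$-formulae). A $T$-functor over $\vec x$ is a functor $X$ from the category of models of $T$ with elementary embeddings to the category of bounded metric spaces with isometric embeddings such that $X(M)$ is a (possibly empty) closed subset of $M^{\vec x}$ for every $M\models T$ and such that $X$ acts on morphisms by restriction: for an elementary embedding $f:M\to N$, the map $X(f)$ is the restriction to $X(M)$ of the map $M^{\vec x}\to N^{\vec x}$ induced by $f$. It is a zeroset if there is a $T$-formula $\theta$ over $\vec x$ such that $X(M)=\{\vec a\in M^{\vec x} : \theta^M(\vec a)=0\}$ for all $M\models T$. It is elementary if $X(N)\cap M^{\vec x}=X(M)$ for all models $M\preceq N$ of $T$ (where $M$ is identified with its image under an elementary embedding into $N$). Put $\hat X=\{p\in\mathbf S_{\vec x}(T) : p=\operatorname{tp}^M(\vec a)\text{ for some }M\models T\text{ and }\vec a\in X(M)\}$. Theorem. Let $X$ be a $T$-functor over $\vec x$. Then $X$ is a zeroset if and only if $X$ is elementary and $\hat X$ is a closed $G_\delta$ subset of $\mathbf S_{\vec x}(T)$. -/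

import Mathlib

universe u

/-- A (many-sorted) signature of continuous logic: a set of sorts, each with a bound on the diameter
of its metric; function symbols with a finite sequence of domain sorts, a target sort and a modulus
of uniform continuity; relation (predicate) symbols with a finite sequence of domain sorts, a
compact interval of values and a modulus of uniform continuity. Constants are function symbols with
no arguments. -/
structure ContLanguage : Type (u + 1) where
  Sorts : Type u
  diam : Sorts → ℝ
  Func : Type u
  funArity : Func → ℕ
  funDom : (f : Func) → Fin (funArity f) → Sorts
  funCod : Func → Sorts
  funMod : Func → ℝ → ℝ
  funMod_pos : ∀ f ε, 0 < ε → 0 < funMod f ε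
  Rel : Type u
  relArity : Rel → ℕ
  relDom : (R : Rel) → Fin (relArity R) → Sorts
  relLo : Rel → ℝ
  relHi : Rel → ℝ
  relMod : Rel → ℝ → ℝ
  relMod_pos : ∀ R ε, 0 < ε → 0 < relMod R ε

namespace ContLanguage

/-- A metric structure for `L`: every sort is a nonempty complete metric space of diameter at most
the bound prescribed by `L`, and the symbols are interpreted by functions that respect the
prescribed moduli of uniform continuity and ranges. Finite products of sorts carry the maximum
metric. -/
structure Structure (L : ContLanguage.{u}) : Type (u + 1) where
  carrier : L.Sorts → Type u
  metric : ∀ s, MetricSpace (carrier s)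
  complete : ∀ s, CompleteSpace (carrier s)
  nonempty : ∀ s, Nonempty (carrier s)
  dist_le : ∀ s (a b : carrier s), dist a b ≤ L.diam s
  funMap : ∀ f : L.Func, (∀ i, carrier (L.funDom f i)) → carrier (L.funCod f)
  funMap_modulus : ∀ (f : L.Func) (ε : ℝ), 0 < ε → ∀ a b : (∀ i, carrier (L.funDom f i)),
    dist a b < L.funMod f ε → dist (funMap f a) (funMap f b) ≤ ε
  relMap : ∀ R : L.Rel, (∀ i, carrier (L.relDom R i)) → ℝ
  relMap_mem : ∀ (R : L.Rel) (a : ∀ i, carrier (L.relDom R i)),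
    relMap R a ∈ Set.Icc (L.relLo R) (L.relHi R)
  relMap_modulus : ∀ (R : L.Rel) (ε : ℝ), 0 < ε → ∀ a b : (∀ i, carrier (L.relDom R i)),
    dist a b < L.relMod R ε → |relMap R a - relMap R b| ≤ ε

attribute [instance] Structure.metric Structure.complete Structure.nonempty

variable {L : ContLanguage.{u}}

/-- The product `M^x`, where `x` is a finite sequence of variables of sorts `x 0, …, x (n - 1)`. -/
abbrev Structure.Tuple (M : L.Structure) {n : ℕ} (x : Fin n → L.Sorts) : Type u :=
  ∀ i, M.carrier (x i)

/-- The tuple `(b, a)` over the sequence of sorts `(s, x)`. -/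
def Structure.consTuple (M : L.Structure) {n : ℕ} {x : Fin n → L.Sorts} {s : L.Sorts}
    (b : M.carrier s) (a : M.Tuple x) : M.Tuple (Fin.cons s x : Fin (n + 1) → L.Sorts) :=
  Fin.cons (α := fun i => M.carrier ((Fin.cons s x : Fin (n + 1) → L.Sorts) i)) b a

variable (L) in
/-- Terms in the variables `x`, indexed by their sort. -/
inductive Term {n : ℕ} (x : Fin n → L.Sorts) : L.Sorts → Type u
  | var (i : Fin n) : Term x (x i)
  | app (f : L.Func) (t : ∀ i : Fin (L.funArity f), Term x (L.funDom f i)) : Term x (L.funCod f)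

/-- The interpretation of a term in a structure. -/
def Term.eval (M : L.Structure) {n : ℕ} {x : Fin n → L.Sorts} (a : M.Tuple x) :
    {s : L.Sorts} → L.Term x s → M.carrier s
  | _, .var i => a i
  | _, .app f t => M.funMap f (fun i => (t i).eval M a)

variable (L) in
/-- Formulae with free variables among `x`: atomic formulae are given by relation symbols and the
metrics on the sorts, connectives are all continuous functions `ℝ ^ k → ℝ`, and quantifiers are
`sup` and `inf` over a sort. In `sup s φ` and `inf s φ`, the bound variable is the variable of index
`0` of `φ`. -/
inductive Formula : {n : ℕ} → (Fin n → L.Sorts) → Type u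
  | rel {n : ℕ} {x : Fin n → L.Sorts} (R : L.Rel)
      (t : ∀ i : Fin (L.relArity R), L.Term x (L.relDom R i)) : Formula x
  | dist {n : ℕ} {x : Fin n → L.Sorts} {s : L.Sorts} (t₁ t₂ : L.Term x s) : Formula x
  | conn {n : ℕ} {x : Fin n → L.Sorts} {k : ℕ} (c : C(Fin k → ℝ, ℝ))
      (φ : Fin k → Formula x) : Formula x
  | sup {n : ℕ} {x : Fin n → L.Sorts} (s : L.Sorts)
      (φ : Formula (Fin.cons s x : Fin (n + 1) → L.Sorts)) : Formula x
  | inf {n : ℕ} {x : Fin n → L.Sorts} (s : L.Sorts)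
      (φ : Formula (Fin.cons s x : Fin (n + 1) → L.Sorts)) : Formula x

/-- The value `φ(a)^M` of a formula at a tuple of a structure. -/
noncomputable def Formula.eval (M : L.Structure) :
    {n : ℕ} → {x : Fin n → L.Sorts} → L.Formula x → M.Tuple x → ℝ
  | _, _, .rel R t, a => M.relMap R (fun i => (t i).eval M a)
  | _, _, .dist t₁ t₂, a => Dist.dist (t₁.eval M a) (t₂.eval M a)
  | _, _, .conn c φ, a => c (fun i => (φ i).eval M a)
  | _, _, .sup s φ, a => ⨆ b : M.carrier s, φ.eval M (M.consTuple b a)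
  | _, _, .inf s φ, a => ⨅ b : M.carrier s, φ.eval M (M.consTuple b a)

/-- The values of a formula are bounded, uniformly over all structures. -/
theorem Formula.exists_bound {n : ℕ} {x : Fin n → L.Sorts} (φ : L.Formula x) :
    ∃ C : ℝ, ∀ (M : L.Structure) (a : M.Tuple x), |φ.eval M a| ≤ C := by
  induction φ with
  | rel R t =>
    refine ⟨max |L.relLo R| |L.relHi R|, fun M a => ?_⟩
    have h := M.relMap_mem R (fun i => (t i).eval M a)
    exact abs_le_max_abs_abs h.1 h.2
  | @dist n x s t₁ t₂ =>
    refine ⟨L.diam s, fun M a => ?_⟩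
    simp only [Formula.eval, abs_of_nonneg dist_nonneg]
    exact M.dist_le s _ _
  | conn c φ ih =>
    choose C hC using ih
    have hK : IsCompact (Set.univ.pi (fun i => Set.Icc (-C i) (C i))) :=
      isCompact_univ_pi (fun i => isCompact_Icc)
    obtain ⟨D, hD⟩ := hK.exists_bound_of_continuousOn c.continuous.continuousOn
    refine ⟨D, fun M a => ?_⟩
    have := hD (fun i => (φ i).eval M a) (fun i _ => abs_le.1 (hC i M a))
    simpa [Formula.eval] using this
  | sup s φ ih =>
    obtain ⟨C, hC⟩ := ih
    refine ⟨C, fun M a => ?_⟩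
    have hb : BddAbove (Set.range fun b : M.carrier s => φ.eval M (M.consTuple b a)) :=
      ⟨C, by rintro _ ⟨b, rfl⟩; exact (abs_le.1 (hC M _)).2⟩
    obtain ⟨b₀⟩ := M.nonempty s
    exact abs_le.2 ⟨(abs_le.1 (hC M _)).1.trans (le_ciSup hb b₀),
      ciSup_le fun b => (abs_le.1 (hC M _)).2⟩
  | inf s φ ih =>
    obtain ⟨C, hC⟩ := ih
    refine ⟨C, fun M a => ?_⟩
    have hb : BddBelow (Set.range fun b : M.carrier s => φ.eval M (M.consTuple b a)) :=
      ⟨-C, by rintro _ ⟨b, rfl⟩; exact (abs_le.1 (hC M _)).1⟩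
    obtain ⟨b₀⟩ := M.nonempty s
    exact abs_le.2 ⟨le_ciInf fun b => (abs_le.1 (hC M _)).1,
      (ciInf_le hb b₀).trans (abs_le.1 (hC M _)).2⟩

variable (L) in
/-- Sentences are formulae without free variables. -/
abbrev Sentence : Type u := L.Formula (Fin.elim0 : Fin 0 → L.Sorts)

/-- The value of a sentence in a structure. -/
noncomputable def Sentence.value (φ : L.Sentence) (M : L.Structure) : ℝ :=
  Formula.eval M φ (fun i => i.elim0)

variable (L) in
/-- A theory is a set of sentences `φ`, standing for the closed conditions `φ = 0`. -/
abbrev Theory : Type u := Set L.Sentence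

/-- The models of the theory `T`. -/
structure Model (T : L.Theory) : Type (u + 1) where
  str : L.Structure
  models : ∀ φ ∈ T, Sentence.value φ str = 0

/-- An elementary embedding: a family of maps between the sorts that preserves the values of all
formulae. (Applied to the metrics and to the formulae `d (f v, w)`, this says in particular that the
maps are isometric and commute with the function symbols.) -/
structure ElementaryEmbedding (M N : L.Structure) : Type u where
  toFun : ∀ s, M.carrier s → N.carrier s
  map_formula : ∀ {n : ℕ} {x : Fin n → L.Sorts} (φ : L.Formula x) (a : M.Tuple x),
    φ.eval N (fun i => toFun (x i) (a i)) = φ.eval M a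

/-- The map `M^x → N^x` induced by an elementary embedding. -/
def ElementaryEmbedding.mapTuple {M N : L.Structure} (f : ElementaryEmbedding M N) {n : ℕ}
    {x : Fin n → L.Sorts} (a : M.Tuple x) : N.Tuple x :=
  fun i => f.toFun (x i) (a i)

section TFormulae

variable (T : L.Theory) {n : ℕ} (x : Fin n → L.Sorts)

theorem bddAbove_range_abs_sub {T : L.Theory} {x : Fin n → L.Sorts} (φ ψ : L.Formula x) :
    BddAbove (Set.range fun p : (Σ M : Model T, M.str.Tuple x) =>
      |φ.eval p.1.str p.2 - ψ.eval p.1.str p.2|) := by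
  obtain ⟨C, hC⟩ := φ.exists_bound
  obtain ⟨D, hD⟩ := ψ.exists_bound
  refine ⟨C + D, ?_⟩
  rintro _ ⟨⟨M, a⟩, rfl⟩
  exact (abs_sub _ _).trans (add_le_add (hC _ _) (hD _ _))

/-- The set of formulae over `x`, considered with the pseudometric `d_{T,x}`. -/
def PreTFormula (_T : L.Theory) {n : ℕ} (x : Fin n → L.Sorts) : Type u := L.Formula x

/-- The pseudometric `d_{T,x}(φ, ψ) = sup |φ(a)^M - ψ(a)^M|`, where the supremum is over all
`M ⊨ T` and all `a ∈ M^x`. -/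
noncomputable instance : PseudoMetricSpace (PreTFormula T x) where
  dist φ ψ := ⨆ p : (Σ M : Model T, M.str.Tuple x),
    |Formula.eval p.1.str φ p.2 - Formula.eval p.1.str ψ p.2|
  dist_self φ := by simp
  dist_comm φ ψ := by simp only [abs_sub_comm]
  dist_triangle φ ψ χ := by
    refine Real.iSup_le (fun p => ?_) (add_nonneg (Real.iSup_nonneg fun _ => abs_nonneg _)
      (Real.iSup_nonneg fun _ => abs_nonneg _))
    exact (abs_sub_le _ _ _).trans (add_le_add
      (le_ciSup (bddAbove_range_abs_sub (T := T) (x := x) φ ψ) p)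
      (le_ciSup (bddAbove_range_abs_sub (T := T) (x := x) ψ χ) p))

/-- The complete metric space of `T`-formulae over `x`: the separated completion of the set of
formulae over `x` with respect to `d_{T,x}`. -/
abbrev TFormula : Type u := UniformSpace.Completion (PreTFormula T x)

variable {T x}

theorem uniformContinuous_eval (M : Model T) (a : M.str.Tuple x) :
    UniformContinuous (fun φ : PreTFormula T x => Formula.eval M.str φ a) := by
  refine LipschitzWith.uniformContinuous (K := 1) (LipschitzWith.of_dist_le_mul fun φ ψ => ?_)
  rw [NNReal.coe_one, one_mul, Real.dist_eq]
  exact le_ciSup (bddAbove_range_abs_sub (T := T) (x := x) φ ψ) ⟨M, a⟩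

/-- The interpretation `θ^M : M^x → ℝ` of a `T`-formula: for each `a`, the unique continuous
extension of `φ ↦ φ(a)^M` from formulae to `T`-formulae. -/
noncomputable def TFormula.interp (θ : TFormula T x) (M : Model T) (a : M.str.Tuple x) : ℝ :=
  UniformSpace.Completion.extension (fun φ : PreTFormula T x => Formula.eval M.str φ a) θ

theorem TFormula.interp_coe (φ : PreTFormula T x) (M : Model T) (a : M.str.Tuple x) :
    TFormula.interp (φ : TFormula T x) M a = Formula.eval M.str φ a :=
  UniformSpace.Completion.extension_coe (uniformContinuous_eval M a) φ

theorem TFormula.continuous_interp (M : Model T) (a : M.str.Tuple x) :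
    Continuous (fun θ : TFormula T x => θ.interp M a) :=
  UniformSpace.Completion.continuous_extension

/-- The complete type `tp^M(a)`, as the functional `θ ↦ θ^M(a)` on the space of `T`-formulae. -/
noncomputable def tp (M : Model T) (a : M.str.Tuple x) : TFormula T x → ℝ :=
  fun θ => θ.interp M a

variable (T x)

/-- The space `S_x(T)` of complete types over `x` in `T`: the types of tuples in models of `T`. -/
def TypeSpace : Type u :=
  {p : TFormula T x → ℝ // ∃ (M : Model T) (a : M.str.Tuple x), p = tp M a}

/-- The logic topology: the weak-* topology on functionals on the space of `T`-formulae, that is,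
the topology of pointwise convergence, restricted to the types. -/
instance : TopologicalSpace (TypeSpace T x) :=
  TopologicalSpace.induced (fun p => (p.1 : TFormula T x → ℝ)) inferInstance

/-- A `T`-functor over `x`: a functor from the category of models of `T` and elementary embeddings
to the category of bounded metric spaces and isometric embeddings, such that `X(M)` is a closed
subset of `M^x` and the map `X(M) → X(N)` assigned to an elementary embedding `M → N` is the
restriction of the induced map `M^x → N^x`. As the maps are prescribed, such a functor is given by
its values on objects, subject to `map_mem`. -/
structure TFunctor : Type (u + 1) where
  obj : ∀ M : Model T, Set (M.str.Tuple x)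
  isClosed_obj : ∀ M, IsClosed (obj M)
  map_mem : ∀ {M N : Model T} (f : ElementaryEmbedding M.str N.str) (a : M.str.Tuple x),
    a ∈ obj M → f.mapTuple a ∈ obj N

variable {T x}

/-- `X` is the zeroset `Z(θ)` of some `T`-formula `θ`. -/
def TFunctor.IsZeroset (X : TFunctor T x) : Prop :=
  ∃ θ : TFormula T x, ∀ M : Model T, X.obj M = {a | θ.interp M a = 0}

/-- `X` is elementary: `X(N) ∩ M = X(M)` whenever `M ⪯ N` are models of `T`. Here `M` is identified
with its image under an elementary embedding of `M` into `N`. -/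
def TFunctor.IsElementary (X : TFunctor T x) : Prop :=
  ∀ (M N : Model T) (f : ElementaryEmbedding M.str N.str),
    X.obj N ∩ Set.range (f.mapTuple (x := x)) = f.mapTuple '' X.obj M

/-- The set of all types `p ∈ S_x(T)` such that `p = tp^M(a)` for some `M ⊨ T` and `a ∈ X(M)`. -/
def TFunctor.typeSet (X : TFunctor T x) : Set (TypeSpace T x) :=
  {p | ∃ (M : Model T) (a : M.str.Tuple x), a ∈ X.obj M ∧ p.1 = tp M a}

end TFormulae

end ContLanguage

/-! The value of a `T`-formula at a tuple depends only on the type of the tuple. A zeroset is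
therefore cut out by the zeros on `TypeSpace T x` of a continuous function `p ↦ p.1 θ`, which form a
closed Gδ set; it is elementary because elementary embeddings preserve types.

The converse combines three facts. If `X` is elementary, membership in `X` depends only on the type:
tuples of the same type become equal in a common elementary extension (`exists_amalgam`), so
membership passes up from one model and down to the other. The space of types is compact Hausdorff,
so a closed Gδ subset is a level set of a continuous function. Finally, every continuous function on
types comes from a `T`-formula (`TypeSpace.exists_tformula`), by Stone–Weierstrass and completeness
of the space of `T`-formulae.

Compactness and amalgamation both rest on metric ultraproducts and
`Formula.tendsto_eval_ultraproduct`. The limit of an ultrafilter of types is realized in the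
ultraproduct of realizing models. The amalgam is an ultrapower of `N` indexed by the assignments of
elements of `N` to names for the elements of `M` and for the variables. -/

open Filter Topology

/-! ### Metric ultraproducts and Łoś's theorem -/

namespace ContLanguage

/-- A bounded real-valued family converges along every ultrafilter. -/
theorem tendsto_limUnder_of_abs_le {I : Type*} (U : Ultrafilter I) {f : I → ℝ} {C : ℝ}
    (h : ∀ i, |f i| ≤ C) : Tendsto f U (𝓝 (limUnder (U : Filter I) f)) := by
  refine tendsto_nhds_limUnder ?_
  obtain ⟨y, -, hy⟩ := (isCompact_Icc (a := -C) (b := C)).ultrafilter_le_nhds (U.map f)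
    (le_principal_iff.2 (Filter.mem_map.2 (Eventually.of_forall fun i => abs_le.1 (h i))))
  exact ⟨y, hy⟩

variable {L : ContLanguage.{u}} {I : Type u} (U : Ultrafilter I) (M : I → L.Structure)

/-- The product of the sorts `s` of a family of structures, to be equipped with the limit of the
metrics along an ultrafilter. -/
def PreUltraproduct (_U : Ultrafilter I) (M : I → L.Structure) (s : L.Sorts) : Type u :=
  ∀ i, (M i).carrier s

theorem tendsto_dist_limUnder {s : L.Sorts} (a b : PreUltraproduct U M s) :
    Tendsto (fun i => dist (a i) (b i)) U (𝓝 (limUnder (U : Filter I) fun i => dist (a i) (b i))) :=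
  tendsto_limUnder_of_abs_le U (C := L.diam s) fun i => by
    rw [abs_of_nonneg dist_nonneg]; exact (M i).dist_le s _ _

noncomputable instance (s : L.Sorts) : PseudoMetricSpace (PreUltraproduct U M s) where
  dist a b := limUnder (U : Filter I) fun i => dist (a i) (b i)
  dist_self a := tendsto_nhds_unique (tendsto_dist_limUnder U M a a) (by simp)
  dist_comm a b := by simp only [dist_comm]
  dist_triangle a b c := le_of_tendsto_of_tendsto' (tendsto_dist_limUnder U M a c)
    ((tendsto_dist_limUnder U M a b).add (tendsto_dist_limUnder U M b c))
    fun i => dist_triangle _ _ _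

namespace PreUltraproduct

variable {U M}

theorem tendsto_dist {s : L.Sorts} (a b : PreUltraproduct U M s) :
    Tendsto (fun i => dist (a i) (b i)) U (𝓝 (dist a b)) :=
  tendsto_dist_limUnder U M a b

/-- Replace the terms of a sequence by the previous ones where they are too far from them. -/
noncomputable def smooth {s : L.Sorts} (u : ℕ → PreUltraproduct U M s) :
    ℕ → PreUltraproduct U M s
  | 0 => u 0
  | k + 1 => fun i => open Classical in
      if dist (smooth u k i) (u (k + 1) i) < 1 / 2 / 2 ^ k then u (k + 1) i else smooth u k i

theorem smooth_succ {s : L.Sorts} (u : ℕ → PreUltraproduct U M s) (k : ℕ) (i : I) :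
    smooth u (k + 1) i = open Classical in
      if dist (smooth u k i) (u (k + 1) i) < 1 / 2 / 2 ^ k then u (k + 1) i else smooth u k i :=
  rfl

theorem dist_smooth_le {s : L.Sorts} (u : ℕ → PreUltraproduct U M s) (i : I) (k : ℕ) :
    dist (smooth u k i) (smooth u (k + 1) i) ≤ 1 / 2 / 2 ^ k := by
  rw [smooth_succ]
  split_ifs with h
  · exact h.le
  · rw [dist_self]; positivity

/-- For fixed `k` only the first `k` comparisons matter, and each succeeds `U`-almost everywhere
because the limit distance is strictly below the threshold. The exceptional set may depend on `k`.
-/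
theorem eventually_smooth_eq {s : L.Sorts} (u : ℕ → PreUltraproduct U M s)
    (hu : ∀ k, dist (u k) (u (k + 1)) < 1 / 2 / 2 ^ k) (k : ℕ) :
    ∀ᶠ i in (U : Filter I), smooth u k i = u k i := by
  induction k with
  | zero => exact Eventually.of_forall fun i => rfl
  | succ k ih =>
    filter_upwards [ih, (tendsto_dist _ _).eventually_lt_const (hu k)] with i h₁ h₂
    rw [smooth_succ, h₁, if_pos h₂]

/-- A rapidly Cauchy sequence need not be Cauchy in any single coordinate. After `smooth` it is so
in all of them, and the coordinatewise limits form the limit. -/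
instance (s : L.Sorts) : CompleteSpace (PreUltraproduct U M s) := by
  refine Metric.complete_of_convergent_controlled_sequences (fun k => 1 / 2 / 2 ^ k)
    (fun k => by positivity) fun u hu => ?_
  have hs := fun i => cauchySeq_of_le_geometric_two (dist_smooth_le u i)
  choose y hy using fun i => cauchySeq_tendsto_of_complete (hs i)
  -- The steps `1 / 2 / 2 ^ k` sum from `k` onwards to `1 / 2 ^ k`, uniformly in the coordinate `i`.
  have hy' : ∀ k i, dist (smooth u k i) (y i) ≤ 1 / 2 ^ k := fun k i =>
    dist_le_of_le_geometric_two_of_tendsto (dist_smooth_le u i) (hy i) k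
  refine ⟨y, tendsto_iff_dist_tendsto_zero.2 (squeeze_zero (fun _ => dist_nonneg) (fun k => ?_)
    (tendsto_pow_atTop_nhds_zero_of_lt_one (r := (1 / 2 : ℝ)) (by norm_num) (by norm_num)))⟩
  refine le_of_tendsto (tendsto_dist (u k) y) ?_
  filter_upwards [eventually_smooth_eq u (fun k => hu k k (k + 1) le_rfl (Nat.le_succ k)) k]
    with i hi
  rw [← hi, one_div_pow]
  exact hy' k i

instance (s : L.Sorts) : Nonempty (PreUltraproduct U M s) :=
  ⟨fun i => Classical.choice ((M i).nonempty s)⟩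

/-- A representative of a point of the separation quotient. -/
noncomputable def rep {s : L.Sorts} (a : SeparationQuotient (PreUltraproduct U M s)) :
    PreUltraproduct U M s :=
  Function.surjInv SeparationQuotient.surjective_mk a

theorem mk_rep {s : L.Sorts} (a : SeparationQuotient (PreUltraproduct U M s)) :
    SeparationQuotient.mk (rep a) = a :=
  Function.surjInv_eq SeparationQuotient.surjective_mk a

theorem eventually_dist_lt {k : ℕ} {y : Fin k → L.Sorts} {a b : ∀ i, PreUltraproduct U M (y i)}
    {δ : ℝ} (hδ : 0 < δ) (h : dist a b < δ) :
    ∀ᶠ j in (U : Filter I), dist (fun i => a i j) (fun i => b i j) < δ := by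
  filter_upwards [eventually_all.2 fun i =>
    (tendsto_dist (a i) (b i)).eventually_lt_const ((dist_pi_lt_iff hδ).1 h i)] with j hj
  exact (dist_pi_lt_iff hδ).2 hj

theorem dist_rep_lt {k : ℕ} {y : Fin k → L.Sorts}
    {a b : ∀ i, SeparationQuotient (PreUltraproduct U M (y i))} {δ : ℝ} (hδ : 0 < δ)
    (h : dist a b < δ) : dist (fun i => rep (a i)) (fun i => rep (b i)) < δ := by
  refine (dist_pi_lt_iff hδ).2 fun i => ?_
  have hi := (dist_pi_lt_iff hδ).1 h i
  rwa [← mk_rep (a i), ← mk_rep (b i), SeparationQuotient.dist_mk] at hi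

/-- Representatives of the same point are at distance zero, hence within every modulus of
continuity. This makes the interpretation of symbols independent of the choice made by `rep`. -/
theorem dist_rep_mk_lt {k : ℕ} {y : Fin k → L.Sorts} (a : ∀ i, PreUltraproduct U M (y i)) {δ : ℝ}
    (hδ : 0 < δ) : dist (fun i => rep (SeparationQuotient.mk (a i))) a < δ := by
  refine (dist_pi_lt_iff hδ).2 fun i => ?_
  rw [← SeparationQuotient.dist_mk, mk_rep, dist_self]
  exact hδ

theorem dist_funMap_le (f : L.Func) {ε : ℝ} (hε : 0 < ε)
    {a b : ∀ i, PreUltraproduct U M (L.funDom f i)} (h : dist a b < L.funMod f ε) :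
    dist (show PreUltraproduct U M (L.funCod f) from fun j => (M j).funMap f fun i => a i j)
      (fun j => (M j).funMap f fun i => b i j) ≤ ε :=
  le_of_tendsto (tendsto_dist _ _) <| by
    filter_upwards [eventually_dist_lt (L.funMod_pos f ε hε) h] with j hj
    exact (M j).funMap_modulus f ε hε _ _ hj

theorem tendsto_relMap (R : L.Rel) (a : ∀ i, PreUltraproduct U M (L.relDom R i)) :
    Tendsto (fun j => (M j).relMap R fun i => a i j) U
      (𝓝 (limUnder (U : Filter I) fun j => (M j).relMap R fun i => a i j)) :=
  tendsto_limUnder_of_abs_le U (C := max |L.relLo R| |L.relHi R|) fun j =>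
    abs_le_max_abs_abs ((M j).relMap_mem R _).1 ((M j).relMap_mem R _).2

theorem abs_limUnder_relMap_sub_le (R : L.Rel) {ε : ℝ} (hε : 0 < ε)
    {a b : ∀ i, PreUltraproduct U M (L.relDom R i)} (h : dist a b < L.relMod R ε) :
    |limUnder (U : Filter I) (fun j => (M j).relMap R fun i => a i j) -
      limUnder (U : Filter I) (fun j => (M j).relMap R fun i => b i j)| ≤ ε :=
  le_of_tendsto ((tendsto_relMap R a).sub (tendsto_relMap R b)).abs <| by
    filter_upwards [eventually_dist_lt (L.relMod_pos R ε hε) h] with j hj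
    exact (M j).relMap_modulus R ε hε _ _ hj

end PreUltraproduct

open PreUltraproduct

/-- The metric ultraproduct of a family of structures. -/
noncomputable def ultraproduct : L.Structure where
  carrier s := SeparationQuotient (PreUltraproduct U M s)
  metric s := inferInstance
  complete s := inferInstance
  nonempty s := inferInstance
  dist_le s a b := by
    rw [← mk_rep a, ← mk_rep b, SeparationQuotient.dist_mk]
    exact le_of_tendsto' (tendsto_dist _ _) fun i => (M i).dist_le s _ _
  funMap f a := SeparationQuotient.mk
    (show PreUltraproduct U M (L.funCod f) from fun j => (M j).funMap f fun i => rep (a i) j)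
  funMap_modulus f ε hε a b h := by
    rw [SeparationQuotient.dist_mk]
    exact dist_funMap_le f hε (dist_rep_lt (L.funMod_pos f ε hε) h)
  relMap R a := limUnder (U : Filter I) fun j => (M j).relMap R fun i => rep (a i) j
  relMap_mem R a := isClosed_Icc.mem_of_tendsto (tendsto_relMap R _)
    (Eventually.of_forall fun j => (M j).relMap_mem R _)
  relMap_modulus R ε hε a b h := abs_limUnder_relMap_sub_le R hε (dist_rep_lt (L.relMod_pos R ε hε) h)

/-- The element of the ultraproduct given by a family of elements. -/
noncomputable def ultraproduct.mk {s : L.Sorts} (a : ∀ i, (M i).carrier s) : (ultraproduct U M).carrier s :=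
  SeparationQuotient.mk (show PreUltraproduct U M s from a)

theorem ultraproduct.mk_surjective (s : L.Sorts) :
    Function.Surjective (ultraproduct.mk U M (s := s)) :=
  SeparationQuotient.surjective_mk (X := PreUltraproduct U M s)

theorem ultraproduct.tendsto_dist_mk {s : L.Sorts} (a b : ∀ i, (M i).carrier s) :
    Tendsto (fun i => dist (a i) (b i)) U (𝓝 (dist (mk U M a) (mk U M b))) :=
  tendsto_dist (U := U) (M := M) a b

theorem ultraproduct.funMap_mk (f : L.Func) (a : ∀ i j, (M j).carrier (L.funDom f i)) :
    (ultraproduct U M).funMap f (fun i => mk U M (a i)) =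
      mk U M fun j => (M j).funMap f fun i => a i j := by
  refine eq_of_forall_dist_le fun ε hε => ?_
  refine (SeparationQuotient.dist_mk _ _).trans_le (dist_funMap_le f hε ?_)
  exact dist_rep_mk_lt (U := U) (M := M) a (L.funMod_pos f ε hε)

theorem ultraproduct.tendsto_relMap_mk (R : L.Rel) (a : ∀ i j, (M j).carrier (L.relDom R i)) :
    Tendsto (fun j => (M j).relMap R fun i => a i j) U
      (𝓝 ((ultraproduct U M).relMap R fun i => mk U M (a i))) := by
  convert tendsto_relMap (U := U) (M := M) R a
  refine eq_of_forall_dist_le fun ε hε => ?_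
  refine (Real.dist_eq _ _).trans_le (abs_limUnder_relMap_sub_le R hε ?_)
  exact dist_rep_mk_lt (U := U) (M := M) a (L.relMod_pos R ε hε)

theorem Term.eval_ultraproduct {n : ℕ} {x : Fin n → L.Sorts} (a : ∀ i j, (M j).carrier (x i))
    {s : L.Sorts} (t : L.Term x s) :
    t.eval (ultraproduct U M) (fun i => ultraproduct.mk U M (a i)) =
      ultraproduct.mk U M fun j => t.eval (M j) fun i => a i j := by
  induction t with
  | var i => rfl
  | app f t ih => simp only [Term.eval, ih, ultraproduct.funMap_mk]

/-- The family of tuples `(b, a)`. -/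
def consFamily {n : ℕ} {x : Fin n → L.Sorts} {s : L.Sorts} (b : ∀ j, (M j).carrier s)
    (a : ∀ i j, (M j).carrier (x i)) (i : Fin (n + 1)) (j : I) :
    (M j).carrier ((Fin.cons s x : Fin (n + 1) → L.Sorts) i) :=
  (M j).consTuple (b j) (fun i => a i j) i

theorem ultraproduct.consTuple_mk {n : ℕ} {x : Fin n → L.Sorts} {s : L.Sorts}
    (b : ∀ j, (M j).carrier s) (a : ∀ i j, (M j).carrier (x i)) :
    (ultraproduct U M).consTuple (mk U M b) (fun i => mk U M (a i)) =
      fun i => mk U M (consFamily M b a i) := by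
  funext i
  refine Fin.cases ?_ (fun i => ?_) i <;> rfl

theorem Formula.bddAbove_range (φ : L.Formula x) (M : L.Structure) {J : Type*}
    (a : J → M.Tuple x) : BddAbove (Set.range fun j => φ.eval M (a j)) := by
  obtain ⟨C, hC⟩ := φ.exists_bound
  exact ⟨C, by rintro _ ⟨j, rfl⟩; exact (abs_le.1 (hC M _)).2⟩

theorem Formula.bddBelow_range (φ : L.Formula x) (M : L.Structure) {J : Type*}
    (a : J → M.Tuple x) : BddBelow (Set.range fun j => φ.eval M (a j)) := by
  obtain ⟨C, hC⟩ := φ.exists_bound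
  exact ⟨-C, by rintro _ ⟨j, rfl⟩; exact (abs_le.1 (hC M _)).1⟩

/-- **Łoś's theorem** for metric ultraproducts. -/
theorem Formula.tendsto_eval_ultraproduct {n : ℕ} {x : Fin n → L.Sorts} (φ : L.Formula x)
    (a : ∀ i j, (M j).carrier (x i)) :
    Tendsto (fun j => φ.eval (M j) fun i => a i j) U
      (𝓝 (φ.eval (ultraproduct U M) fun i => ultraproduct.mk U M (a i))) := by
  induction φ with
  | rel R t =>
    simp only [Formula.eval, Term.eval_ultraproduct]
    exact ultraproduct.tendsto_relMap_mk U M R _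
  | dist t₁ t₂ =>
    simp only [Formula.eval, Term.eval_ultraproduct]
    exact ultraproduct.tendsto_dist_mk U M _ _
  | conn c φ ih =>
    exact (c.continuous.tendsto _).comp (tendsto_pi_nhds.2 fun i => ih i a)
  | sup s φ ih =>
    simp only [Formula.eval]
    have key := fun b : ∀ j, (M j).carrier s => ih (consFamily M b a)
    simp only [← ultraproduct.consTuple_mk] at key
    refine tendsto_order.2 ⟨fun r hr => ?_, fun r hr => ?_⟩
    · obtain ⟨b, hb⟩ := exists_lt_of_lt_ciSup hr
      obtain ⟨b, rfl⟩ := ultraproduct.mk_surjective U M s b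
      filter_upwards [(key b).eventually_const_lt hb] with j hj
      exact hj.trans_le (le_ciSup (φ.bddAbove_range (M j) fun b => (M j).consTuple b fun i => a i j) (b j))
    · obtain ⟨q, hq, hqr⟩ := exists_between hr
      -- Coordinatewise witnesses within `r - q` of the supremum define one element of the
      -- ultraproduct. Its value is below `q`, so the suprema are eventually below `q + (r - q) =
      -- r`.
      have : ∀ j, ∃ b : (M j).carrier s, (⨆ b, φ.eval (M j) ((M j).consTuple b fun i => a i j)) -
          (r - q) < φ.eval (M j) ((M j).consTuple b fun i => a i j) := fun j =>
        exists_lt_of_lt_ciSup (sub_lt_self _ (sub_pos.2 hqr))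
      choose b hb using this
      have h := (le_ciSup (φ.bddAbove_range (ultraproduct U M) _)
        (ultraproduct.mk U M b)).trans_lt hq
      filter_upwards [(key b).eventually_lt_const h] with j hj
      have h' : φ.eval (M j) ((M j).consTuple (b j) fun i => a i j) < q := hj
      linarith [hb j]
  | inf s φ ih =>
    simp only [Formula.eval]
    have key := fun b : ∀ j, (M j).carrier s => ih (consFamily M b a)
    simp only [← ultraproduct.consTuple_mk] at key
    refine tendsto_order.2 ⟨fun r hr => ?_, fun r hr => ?_⟩
    · obtain ⟨q, hrq, hq⟩ := exists_between hr
      have : ∀ j, ∃ b : (M j).carrier s, φ.eval (M j) ((M j).consTuple b fun i => a i j) <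
          (⨅ b, φ.eval (M j) ((M j).consTuple b fun i => a i j)) + (q - r) := fun j =>
        exists_lt_of_ciInf_lt (lt_add_of_pos_right _ (sub_pos.2 hrq))
      choose b hb using this
      have h := hq.trans_le (ciInf_le (φ.bddBelow_range (ultraproduct U M) _)
        (ultraproduct.mk U M b))
      filter_upwards [(key b).eventually_const_lt h] with j hj
      have h' : q < φ.eval (M j) ((M j).consTuple (b j) fun i => a i j) := hj
      linarith [hb j]
    · obtain ⟨b, hb⟩ := exists_lt_of_ciInf_lt hr
      obtain ⟨b, rfl⟩ := ultraproduct.mk_surjective U M s b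
      filter_upwards [(key b).eventually_lt_const hb] with j hj
      exact (ciInf_le (φ.bddBelow_range (M j) fun b => (M j).consTuple b fun i => a i j) (b j)).trans_lt hj

end ContLanguage

/-! ### Substitution and renaming of variables -/

namespace ContLanguage

variable {L : ContLanguage.{u}}

/-- Substitution of terms for the variables of a term. -/
def Term.subst {m : ℕ} {y : Fin m → L.Sorts} {n : ℕ} {x : Fin n → L.Sorts}
    (σ : ∀ i, L.Term y (x i)) : {s : L.Sorts} → L.Term x s → L.Term y s
  | _, .var i => σ i
  | _, .app f t => .app f fun i => (t i).subst σ

theorem Term.eval_subst (M : L.Structure) {m : ℕ} {y : Fin m → L.Sorts} {n : ℕ}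
    {x : Fin n → L.Sorts} (σ : ∀ i, L.Term y (x i)) (b : M.Tuple y) {s : L.Sorts}
    (t : L.Term x s) : (t.subst σ).eval M b = t.eval M fun i => (σ i).eval M b := by
  induction t with
  | var i => rfl
  | app f t ih => simp only [Term.subst, Term.eval, ih]

/-- Weakening of the context of a term by a variable of index `0`. -/
def Term.shift {m : ℕ} {y : Fin m → L.Sorts} (s' : L.Sorts) {s : L.Sorts} (t : L.Term y s) :
    L.Term (Fin.cons s' y : Fin (m + 1) → L.Sorts) s :=
  t.subst fun i => Term.var (x := (Fin.cons s' y : Fin (m + 1) → L.Sorts)) i.succ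

/-- The substitution under a quantifier that corresponds to `σ`. -/
def Term.lift {m : ℕ} {y : Fin m → L.Sorts} {n : ℕ} {x : Fin n → L.Sorts}
    (σ : ∀ i, L.Term y (x i)) (s : L.Sorts) (i : Fin (n + 1)) :
    L.Term (Fin.cons s y : Fin (m + 1) → L.Sorts) ((Fin.cons s x : Fin (n + 1) → L.Sorts) i) :=
  Fin.cases (motive := fun i => L.Term (Fin.cons s y : Fin (m + 1) → L.Sorts)
      ((Fin.cons s x : Fin (n + 1) → L.Sorts) i))
    (Term.var (x := (Fin.cons s y : Fin (m + 1) → L.Sorts)) 0) (fun i => (σ i).shift s) i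

theorem Term.eval_lift (M : L.Structure) {m : ℕ} {y : Fin m → L.Sorts} {n : ℕ}
    {x : Fin n → L.Sorts} (σ : ∀ i, L.Term y (x i)) {s : L.Sorts} (c : M.carrier s)
    (b : M.Tuple y) :
    (fun i => (Term.lift σ s i).eval M (M.consTuple c b)) =
      M.consTuple c fun i => (σ i).eval M b := by
  funext i
  refine Fin.cases ?_ (fun i => ?_) i
  · rfl
  · exact Term.eval_subst M _ _ (σ i)

/-- Substitution of terms for the free variables of a formula. -/
def Formula.subst : {n : ℕ} → {x : Fin n → L.Sorts} → L.Formula x → {m : ℕ} →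
    {y : Fin m → L.Sorts} → (∀ i, L.Term y (x i)) → L.Formula y
  | _, _, .rel R t, _, _, σ => .rel R fun i => (t i).subst σ
  | _, _, .dist t₁ t₂, _, _, σ => .dist (t₁.subst σ) (t₂.subst σ)
  | _, _, .conn c φ, _, _, σ => .conn c fun i => (φ i).subst σ
  | _, _, .sup s φ, _, _, σ => .sup s (φ.subst (Term.lift σ s))
  | _, _, .inf s φ, _, _, σ => .inf s (φ.subst (Term.lift σ s))

theorem Formula.eval_subst (M : L.Structure) {n : ℕ} {x : Fin n → L.Sorts} (φ : L.Formula x)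
    {m : ℕ} {y : Fin m → L.Sorts} (σ : ∀ i, L.Term y (x i)) (b : M.Tuple y) :
    (φ.subst σ).eval M b = φ.eval M fun i => (σ i).eval M b := by
  induction φ generalizing m with
  | rel R t => simp only [Formula.subst, Formula.eval, Term.eval_subst]
  | dist t₁ t₂ => simp only [Formula.subst, Formula.eval, Term.eval_subst]
  | conn c φ ih => simp only [Formula.subst, Formula.eval, ih]
  | sup s φ ih => simp only [Formula.subst, Formula.eval, ih, Term.eval_lift]
  | inf s φ ih => simp only [Formula.subst, Formula.eval, ih, Term.eval_lift]

section Realization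

variable {E : Type u} (so : E → L.Sorts)

/-- A formula in variables `t i` can be rewritten as a formula in any variables that include the
`t i`. -/
theorem Formula.exists_rename {m k : ℕ} (t : Fin m → E) (t' : Fin k → E)
    (h : ∀ i, ∃ j, t' j = t i) (φ : L.Formula fun i => so (t i)) :
    ∃ φ' : L.Formula fun i => so (t' i), ∀ (P : L.Structure) (p : ∀ e, P.carrier (so e)),
      φ'.eval P (fun i => p (t' i)) = φ.eval P fun i => p (t i) := by
  choose π hπ using h
  -- Replacing `t` by `t' ∘ π` makes the sorts agree definitionally, so no casts are needed.
  obtain rfl : (fun i => t' (π i)) = t := funext hπ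
  exact ⟨φ.subst fun i => .var (x := fun i => so (t' i)) (π i), fun P p =>
    φ.eval_subst P _ _⟩

/-- A quantifier over one of finitely many variables. -/
theorem Formula.exists_inf_variable {k : ℕ} (e : E) (t : Fin k → E)
    (φ : L.Formula fun i => so ((Fin.cons e t : Fin (k + 1) → E) i)) :
    ∃ φ' : L.Formula (Fin.cons (so e) (fun i => so (t i)) : Fin (k + 1) → L.Sorts),
      ∀ (P : L.Structure) (p : ∀ e, P.carrier (so e)),
      φ'.eval P (P.consTuple (p e) fun i => p (t i)) =
        φ.eval P fun i => p ((Fin.cons e t : Fin (k + 1) → E) i) := by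
  -- Each variable is sent to itself. A substitution is still needed, since applying `so` after
  -- `Fin.cons` agrees with `Fin.cons` of the sorts only after a case distinction on the index.
  refine ⟨φ.subst fun i => Fin.cases
    (motive := fun i => L.Term (Fin.cons (so e) (fun i => so (t i)) : Fin (k + 1) → L.Sorts)
      (so ((Fin.cons e t : Fin (k + 1) → E) i)))
    (Term.var (x := (Fin.cons (so e) (fun i => so (t i)) : Fin (k + 1) → L.Sorts)) 0)
    (fun i => Term.var (x := (Fin.cons (so e) (fun i => so (t i)) : Fin (k + 1) → L.Sorts)) i.succ)
    i, fun P p => ?_⟩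
  rw [Formula.eval_subst]
  congr 1
  funext i
  refine Fin.cases ?_ (fun i => ?_) i <;> rfl

end Realization

/-! ### Amalgamation of tuples of the same type -/

section Amalgamation

variable {n : ℕ} {x : Fin n → L.Sorts} {M N : L.Structure}

/-- Names for the elements of `M` and for the variables `x`. -/
abbrev Name (M : L.Structure) {n : ℕ} (_x : Fin n → L.Sorts) : Type u := (Σ s, M.carrier s) ⊕ ULift.{u} (Fin n)

/-- The sort of a name. -/
def Name.so : Name M x → L.Sorts
  | .inl c => c.1
  | .inr j => x j.down

/-- The element of `M` with a given name, where the variables `x` name the tuple `a`. -/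
def Name.val (a : M.Tuple x) : ∀ e : Name M x, M.carrier e.so
  | .inl c => c.2
  | .inr j => a j.down

/-- The elements of `S` are quantified away one at a time by `inf`. What remains is a formula in `x`
alone, which has the same value at `a` and at `b`; witnesses in `N` are then chosen back through the
quantifiers. A strict upper bound survives each step although infima need not be attained. -/
theorem exists_names_lt {a : M.Tuple x} {b : N.Tuple x}
    (hab : ∀ φ : L.Formula x, φ.eval M a = φ.eval N b) (S : Finset (Σ s, M.carrier s)) {k : ℕ}
    (t : Fin k → Name M x) (ht : ∀ i c, t i = .inl c → c ∈ S)
    (φ : L.Formula fun i => (t i).so) (r : ℝ) (hr : φ.eval M (fun i => Name.val a (t i)) < r) :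
    ∃ h : ∀ e : Name M x, N.carrier e.so, (∀ j, h (.inr j) = b j.down) ∧
      φ.eval N (fun i => h (t i)) < r := by
  classical
  induction S using Finset.induction_on generalizing k r with
  | empty =>
    have h : ∀ i, ∃ j : Fin n, Sum.inr (ULift.up j) = t i := fun i => by
      rcases h : t i with c | j
      · exact absurd (ht i c h) (Finset.notMem_empty c)
      · exact ⟨j.down, rfl⟩
    obtain ⟨φ', hφ'⟩ := φ.exists_rename Name.so t _ h
    let p : ∀ e : Name M x, N.carrier e.so := fun e => match e with
      | .inl c => Classical.choice (N.nonempty c.1)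
      | .inr j => b j.down
    refine ⟨p, fun _ => rfl, ?_⟩
    rw [← hφ'] at hr ⊢
    exact (hab φ').symm.trans_lt hr
  | insert e S he ih =>
    -- The name of `e` may occur in `t` repeatedly or not at all. Listing the other names without
    -- repetition and putting `e` in front covers all cases, so a single quantifier removes it.
    let F := (Finset.univ.image t).erase (.inl e)
    let t' : Fin F.card → Name M x := fun i => (F.equivFin.symm i).1
    have ht' : ∀ i, t' i ≠ .inl e := fun i => (Finset.mem_erase.1 (F.equivFin.symm i).2).1
    have h : ∀ i, ∃ j, (Fin.cons (.inl e) t' : Fin (F.card + 1) → Name M x) j = t i := fun i => by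
      by_cases hi : t i = .inl e
      · exact ⟨0, hi.symm⟩
      · refine ⟨(F.equivFin ⟨t i, Finset.mem_erase.2
          ⟨hi, Finset.mem_image_of_mem t (Finset.mem_univ i)⟩⟩).succ, ?_⟩
        simp [t']
    obtain ⟨φ₁, hφ₁⟩ := φ.exists_rename Name.so t _ h
    obtain ⟨φ₂, hφ₂⟩ := φ₁.exists_inf_variable Name.so (.inl e) t'
    have hinf : (Formula.inf _ φ₂).eval M (fun i => Name.val a (t' i)) < r := by
      refine lt_of_le_of_lt (ciInf_le (φ₂.bddBelow_range M _) (Name.val a (.inl e))) ?_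
      rwa [hφ₂, hφ₁]
    obtain ⟨h, hb, hlt⟩ := ih t' (fun i c hc => by
      have hF := (Finset.mem_erase.1 (F.equivFin.symm i).2).2
      obtain ⟨j, -, hj⟩ := Finset.mem_image.1 hF
      rcases Finset.mem_insert.1 (ht j c (hj.trans hc)) with rfl | h
      · exact absurd hc (ht' i)
      · exact h) (Formula.inf _ φ₂) r hinf
    obtain ⟨d, hd⟩ := exists_lt_of_ciInf_lt hlt
    refine ⟨Function.update h (.inl e) d, fun j =>
      (Function.update_of_ne Sum.inr_ne_inl _ _).trans (hb j), ?_⟩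
    have h' : (fun i => Function.update h (.inl e) d (t' i)) = fun i => h (t' i) :=
      funext fun i => Function.update_of_ne (ht' i) _ _
    rwa [← hφ₁, ← hφ₂, h', Function.update_self]

/-- Requirements on the images of named elements. -/
structure Requirement (M : L.Structure) {n : ℕ} (x : Fin n → L.Sorts) : Type u where
  card : ℕ
  names : Fin card → Name M x
  formula : L.Formula fun i => (names i).so
  bound : ℕ

/-- An assignment of elements of `N` to names satisfies a requirement, approximately. -/
def Requirement.holds (a : M.Tuple x) (b : N.Tuple x) (q : Requirement M x) :
    Set (∀ e : Name M x, N.carrier e.so) :=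
  {h | (∀ j, h (.inr j) = b j.down) ∧ |q.formula.eval N (fun i => h (q.names i)) -
    q.formula.eval M (fun i => Name.val a (q.names i))| < 1 / (q.bound + 1)}

theorem Requirement.exists_holds {a : M.Tuple x} {b : N.Tuple x}
    (hab : ∀ φ : L.Formula x, φ.eval M a = φ.eval N b) (Q : Finset (Requirement M x)) :
    ∃ h, ∀ q ∈ Q, h ∈ q.holds a b := by
  classical
  let F := Q.biUnion fun q => Finset.univ.image q.names
  let t : Fin F.card → Name M x := fun i => (F.equivFin.symm i).1
  have ht : ∀ q : Q, ∀ i, ∃ j, t j = q.1.names i := fun q i =>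
    ⟨F.equivFin ⟨q.1.names i, Finset.mem_biUnion.2
      ⟨q.1, q.2, Finset.mem_image_of_mem _ (Finset.mem_univ i)⟩⟩, by simp [t]⟩
  choose φ hφ using fun q : Q => q.1.formula.exists_rename Name.so _ t (ht q)
  let v : Q → ℝ := fun q => (φ q).eval M fun i => Name.val a (t i)
  let δ : Q → ℝ := fun q => q.1.bound + 1
  have hδ : ∀ q, 0 < δ q := fun q => by positivity
  -- One connective encodes all requirements: the weighted sum of deviations vanishes in `M`, and a
  -- value below `1` in `N` bounds each deviation by the inverse of its weight.
  let c : C(Fin Q.card → ℝ, ℝ) :=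
    ⟨fun w => ∑ i, δ (Q.equivFin.symm i) * |w i - v (Q.equivFin.symm i)|, by fun_prop⟩
  let S : Finset (Σ s, M.carrier s) := F.preimage Sum.inl Sum.inl_injective.injOn
  obtain ⟨h, hb, hlt⟩ := exists_names_lt hab S t
    (fun i c hc => Finset.mem_preimage.2 (hc ▸ (F.equivFin.symm i).2))
    (.conn c fun i => φ (Q.equivFin.symm i)) 1 (by simp [Formula.eval, c, v])
  refine ⟨h, fun q hq => ⟨hb, ?_⟩⟩
  have hle : δ ⟨q, hq⟩ * |(φ ⟨q, hq⟩).eval N (fun i => h (t i)) - v ⟨q, hq⟩| < 1 := by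
    refine lt_of_le_of_lt ?_ hlt
    have := Finset.single_le_sum (f := fun i => δ (Q.equivFin.symm i) *
      |(φ (Q.equivFin.symm i)).eval N (fun i => h (t i)) - v (Q.equivFin.symm i)|)
      (fun i _ => mul_nonneg (hδ _).le (abs_nonneg _)) (Finset.mem_univ (Q.equivFin ⟨q, hq⟩))
    simpa [Formula.eval, c] using this
  rw [← hφ ⟨q, hq⟩, ← hφ ⟨q, hq⟩, lt_div_iff₀' (by positivity)]
  exact hle

/-- Tuples with the same type can be identified in a common elementary extension. -/
theorem exists_amalgam {a : M.Tuple x} {b : N.Tuple x}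
    (hab : ∀ φ : L.Formula x, φ.eval M a = φ.eval N b) :
    ∃ (K : L.Structure) (f : ElementaryEmbedding M K) (g : ElementaryEmbedding N K),
      f.mapTuple a = g.mapTuple b := by
  classical
  -- These sets have the finite intersection property by `Requirement.exists_holds`, so some
  -- ultrafilter on assignments contains them all. In the ultrapower of `N`, a name denotes the
  -- class of its evaluation map.
  let G : Set (Set (∀ e : Name M x, N.carrier e.so)) :=
    Set.range fun q : Requirement M x => q.holds a b
  have hG : (generate G).NeBot := by
    refine generate_neBot_iff.2 fun t htG ht => ?_
    obtain ⟨t, rfl⟩ := ht.exists_finset_coe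
    obtain ⟨Q, -, rfl⟩ := Finset.subset_set_image_iff.1 (htG.trans Set.image_univ.superset)
    obtain ⟨h, hh⟩ := Requirement.exists_holds hab Q
    exact ⟨h, by simpa using hh⟩
  let U := Ultrafilter.of (generate G)
  have hU : ∀ q : Requirement M x, ∀ᶠ h in (U : Filter _), h ∈ q.holds a b := fun q =>
    Ultrafilter.of_le _ (mem_generate_of_mem ⟨q, rfl⟩)
  let K := ultraproduct U fun _ => N
  have hK : ∀ {m : ℕ} (t : Fin m → Name M x) (φ : L.Formula fun i => (t i).so),
      φ.eval K (fun i => ultraproduct.mk U (fun _ => N) fun h => h (t i)) =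
        φ.eval M fun i => Name.val a (t i) := fun t φ => by
    refine tendsto_nhds_unique (φ.tendsto_eval_ultraproduct U (fun _ => N) fun i h => h (t i)) ?_
    refine Metric.tendsto_nhds.2 fun ε hε => ?_
    -- Each accuracy `1 / (k + 1)` is a requirement of its own, so the limit value is exact.
    obtain ⟨k, hk⟩ := exists_nat_one_div_lt hε
    filter_upwards [hU ⟨_, t, φ, k⟩] with h hh
    exact hh.2.trans hk
  refine ⟨K, ⟨fun s c => ultraproduct.mk U (fun _ => N) fun h => h (.inl ⟨s, c⟩), fun φ c =>
    hK (fun i => .inl ⟨_, c i⟩) φ⟩, ⟨fun s c => ultraproduct.mk U (fun _ => N) fun _ => c,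
    fun φ c => tendsto_nhds_unique
      (φ.tendsto_eval_ultraproduct U (fun _ => N) fun i _ => c i) tendsto_const_nhds⟩, ?_⟩
  funext j
  -- In `M` the element `a j` and the variable `j` denote the same point, so their distance is zero
  -- in `K` too. There the variable denotes the diagonal image of `b j`.
  have key := hK ![.inl ⟨x j, a j⟩, .inr ⟨j⟩] (.dist (s := x j)
    (.var (x := fun i => (![.inl ⟨x j, a j⟩, .inr ⟨j⟩] : Fin 2 → Name M x) i |>.so) 0)
    (.var (x := fun i => (![.inl ⟨x j, a j⟩, .inr ⟨j⟩] : Fin 2 → Name M x) i |>.so) 1))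
  refine (dist_eq_zero.1 (key.trans (dist_self (a j)))).trans ?_
  refine dist_eq_zero.1 (tendsto_nhds_unique (ultraproduct.tendsto_dist_mk U _ _ _) ?_)
  refine tendsto_const_nhds.congr' ?_
  -- A requirement with a constant formula retains only the condition that variables are sent to
  -- `b`.
  filter_upwards [hU ⟨0, Fin.elim0, .conn (k := 0) ⟨fun _ => 0, continuous_const⟩ Fin.elim0, 0⟩]
    with h hh
  exact (dist_eq_zero.2 (hh.1 ⟨j⟩)).symm

end Amalgamation

end ContLanguage

/-! ### The compact space of types and its continuous functions -/

namespace ContLanguage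

variable {L : ContLanguage.{u}} {T : L.Theory} {n : ℕ} {x : Fin n → L.Sorts}

theorem TFormula.lipschitzWith_interp (M : Model T) (a : M.str.Tuple x) :
    LipschitzWith 1 (fun θ : TFormula T x => θ.interp M a) :=
  LipschitzWith.completion_extension <| LipschitzWith.of_dist_le_mul fun φ ψ => by
    rw [NNReal.coe_one, one_mul, Real.dist_eq]
    exact le_ciSup (bddAbove_range_abs_sub (T := T) (x := x) φ ψ) ⟨M, a⟩

/-- Elementary embeddings preserve the values of `T`-formulae. -/
theorem TFormula.interp_mapTuple {M N : Model T} (f : ElementaryEmbedding M.str N.str)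
    (θ : TFormula T x) (a : M.str.Tuple x) : θ.interp N (f.mapTuple a) = θ.interp M a := by
  induction θ using UniformSpace.Completion.induction_on with
  | hp => exact isClosed_eq (TFormula.continuous_interp _ _) (TFormula.continuous_interp _ _)
  | ih φ => rw [TFormula.interp_coe, TFormula.interp_coe]; exact f.map_formula φ a

theorem ElementaryEmbedding.dist_map {M N : L.Structure} (f : ElementaryEmbedding M N)
    {s : L.Sorts} (a b : M.carrier s) : dist (f.toFun s a) (f.toFun s b) = dist a b :=
  f.map_formula (x := fun _ : Fin 2 => s) 
    (.dist (.var (x := fun _ => s) 0) (.var (x := fun _ => s) 1))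
    ![a, b]

theorem ElementaryEmbedding.mapTuple_injective {M N : L.Structure} (f : ElementaryEmbedding M N) :
    Function.Injective (f.mapTuple (x := x)) := fun _ _ h => funext fun i =>
  dist_eq_zero.1 ((f.dist_map _ _).symm.trans (dist_eq_zero.2 (congrFun h i)))

/-- Ensures that the amalgam of two models of `T` is again a model of `T`. -/
theorem ElementaryEmbedding.models {M N : L.Structure} (f : ElementaryEmbedding M N)
    (hM : ∀ φ ∈ T, Sentence.value φ M = 0) : ∀ φ ∈ T, Sentence.value φ N = 0 := fun φ hφ => by
  rw [← hM φ hφ, Sentence.value, Sentence.value, ← f.map_formula φ]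
  congr 1
  exact funext fun i => i.elim0

namespace TypeSpace

theorem lipschitzWith (p : TypeSpace T x) : LipschitzWith 1 p.1 := by
  obtain ⟨_, M, a, rfl⟩ := p
  exact TFormula.lipschitzWith_interp M a

theorem continuous_apply (θ : TFormula T x) : Continuous fun p : TypeSpace T x => p.1 θ :=
  (_root_.continuous_apply θ).comp continuous_induced_dom

instance : T2Space (TypeSpace T x) :=
  T2Space.of_injective_continuous (f := fun p : TypeSpace T x => (p.1 : TFormula T x → ℝ))
    Subtype.val_injective continuous_induced_dom

/-- The type of a tuple, as a point of the space of types. -/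
noncomputable def of (M : Model T) (a : M.str.Tuple x) : TypeSpace T x := ⟨tp M a, M, a, rfl⟩

/-- A model that realizes a given type. -/
noncomputable def model (p : TypeSpace T x) : Model T := p.2.choose

/-- A realization of a given type. -/
noncomputable def realization (p : TypeSpace T x) : p.model.str.Tuple x := p.2.choose_spec.choose

theorem apply_coe (p : TypeSpace T x) (φ : L.Formula x) :
    p.1 (show PreTFormula T x from φ) = φ.eval p.model.str p.realization :=
  (congrFun p.2.choose_spec.choose_spec _).trans (TFormula.interp_coe _ _ _)

theorem ext_formula {p q : TypeSpace T x} (h : ∀ φ : PreTFormula T x, p.1 φ = q.1 φ) : p = q := by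
  refine Subtype.ext (funext fun θ => ?_)
  induction θ using UniformSpace.Completion.induction_on with
  | hp => exact isClosed_eq p.lipschitzWith.continuous q.lipschitzWith.continuous
  | ih φ => exact h φ

/-- Types are 1-Lipschitz, hence equicontinuous, so convergence on the dense set of formulae
suffices. -/
theorem tendsto_of_formula {F : Filter (TypeSpace T x)} {p : TypeSpace T x}
    (h : ∀ φ : PreTFormula T x, Tendsto (fun q : TypeSpace T x => q.1 φ) F (𝓝 (p.1 φ))) :
    F ≤ 𝓝 p := by
  rw [nhds_induced, ← tendsto_iff_comap, tendsto_pi_nhds]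
  intro θ
  refine Metric.tendsto_nhds.2 fun ε hε => ?_
  obtain ⟨φ, hφ⟩ := UniformSpace.Completion.denseRange_coe.exists_dist_lt θ
    (show 0 < ε / 3 by positivity)
  filter_upwards [Metric.tendsto_nhds.1 (h φ) (ε / 3) (by positivity)] with q hq
  have hp := (p.lipschitzWith.dist_le_mul θ φ).trans_lt (by rwa [NNReal.coe_one, one_mul])
  have hq' := (q.lipschitzWith.dist_le_mul θ φ).trans_lt (by rwa [NNReal.coe_one, one_mul])
  rw [dist_comm] at hp
  linarith [dist_triangle4 (q.1 θ) (q.1 φ) (p.1 φ) (p.1 θ)]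

/-- The compactness theorem. -/
instance : CompactSpace (TypeSpace T x) := by
  refine ⟨isCompact_iff_ultrafilter_le_nhds.2 fun U _ => ?_⟩
  -- The ultrafilter lives on the space of types itself, so the types serve as indices, each with a
  -- model realizing it.
  let K : Model T := ⟨ultraproduct U fun p => p.model.str, fun φ hφ => by
    have h := Formula.tendsto_eval_ultraproduct U (fun p : TypeSpace T x => p.model.str) φ
      fun i _ => i.elim0
    have h₀ : ∀ (P : L.Structure) (c : P.Tuple Fin.elim0), φ.eval P c = Sentence.value φ P :=
      fun P c => congrArg (φ.eval P) (funext fun i => i.elim0)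
    simp only [h₀, Model.models _ φ hφ] at h
    exact tendsto_nhds_unique h tendsto_const_nhds⟩
  let a : K.str.Tuple x := fun i => ultraproduct.mk U _ fun p => p.realization i
  refine ⟨of K a, Set.mem_univ _, tendsto_of_formula fun φ => ?_⟩
  have h := Formula.tendsto_eval_ultraproduct U _ φ fun i (p : TypeSpace T x) => p.realization i
  refine (h.congr fun p => (p.apply_coe φ).symm).trans_eq ?_
  exact congrArg 𝓝 (TFormula.interp_coe (T := T) φ K a).symm

/-- The function on types defined by a formula. -/
noncomputable def evalMap (φ : L.Formula x) : C(TypeSpace T x, ℝ) :=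
  ⟨fun p => p.1 (show PreTFormula T x from φ), continuous_apply _⟩

/-- Serves to turn uniform Cauchy sequences of functions on types into Cauchy sequences for
`d_{T,x}`. -/
theorem dist_le_dist_evalMap (φ ψ : PreTFormula T x) :
    dist φ ψ ≤ dist (evalMap (T := T) φ) (evalMap ψ) := by
  refine Real.iSup_le (fun ⟨M, a⟩ => ?_) dist_nonneg
  have h := ContinuousMap.dist_apply_le_dist (f := evalMap (T := T) φ) (g := evalMap ψ)
    (of M a)
  rw [Real.dist_eq] at h
  convert h using 3 <;> exact (TFormula.interp_coe _ _ _).symm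

theorem evalMap_conn {k : ℕ} (c : C(Fin k → ℝ, ℝ)) (φ : Fin k → L.Formula x) (p : TypeSpace T x) :
    evalMap (.conn c φ) p = c fun i => evalMap (φ i) p := by
  simp only [evalMap, ContinuousMap.coe_mk, apply_coe, Formula.eval]

variable (T x) in
/-- The algebra of functions on types defined by formulae. -/
def evalSubalgebra : Subalgebra ℝ C(TypeSpace T x, ℝ) where
  carrier := Set.range evalMap
  mul_mem' := by
    rintro _ _ ⟨φ, rfl⟩ ⟨ψ, rfl⟩
    exact ⟨.conn (k := 2) ⟨fun v => v 0 * v 1, by fun_prop⟩ ![φ, ψ],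
      ContinuousMap.ext fun p => evalMap_conn _ _ p⟩
  add_mem' := by
    rintro _ _ ⟨φ, rfl⟩ ⟨ψ, rfl⟩
    exact ⟨.conn (k := 2) ⟨fun v => v 0 + v 1, by fun_prop⟩ ![φ, ψ],
      ContinuousMap.ext fun p => evalMap_conn _ _ p⟩
  algebraMap_mem' r := ⟨.conn (k := 0) ⟨fun _ => r, by fun_prop⟩ Fin.elim0,
      ContinuousMap.ext fun p => evalMap_conn _ _ p⟩

/-- Every continuous function on the space of types is given by a `T`-formula. -/
theorem exists_tformula (g : C(TypeSpace T x, ℝ)) :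
    ∃ θ : TFormula T x, ∀ p : TypeSpace T x, p.1 θ = g p := by
  -- Stone–Weierstrass: distinct types differ on some formula, by `ext_formula`.
  have hdense := ContinuousMap.subalgebra_topologicalClosure_eq_top_of_separatesPoints
    (evalSubalgebra T x) fun p q hpq => by
      by_contra! h
      exact hpq (ext_formula fun φ => h _ ⟨evalMap φ, ⟨φ, rfl⟩, rfl⟩)
  have hg : g ∈ closure (Set.range (evalMap (T := T) (x := x))) := by
    have : g ∈ (evalSubalgebra T x).topologicalClosure := hdense ▸ Algebra.mem_top
    exact this
  obtain ⟨u, hu, hug⟩ := mem_closure_iff_seq_limit.1 hg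
  choose φ hφ using hu
  obtain rfl : (fun k => evalMap (φ k)) = u := funext hφ
  have hc : CauchySeq fun k => ((show PreTFormula T x from φ k : PreTFormula T x) : TFormula T x) := by
    refine Metric.cauchySeq_iff.2 fun ε hε => ?_
    obtain ⟨N, hN⟩ := Metric.cauchySeq_iff.1 hug.cauchySeq ε hε
    refine ⟨N, fun k hk l hl => ?_⟩
    rw [UniformSpace.Completion.dist_eq]
    exact (dist_le_dist_evalMap _ _).trans_lt (hN k hk l hl)
  obtain ⟨θ, hθ⟩ := cauchySeq_tendsto_of_complete hc
  refine ⟨θ, fun p => tendsto_nhds_unique ((p.lipschitzWith.continuous.tendsto θ).comp hθ) ?_⟩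
  exact ((ContinuousEvalConst.continuous_eval_const p).tendsto g).comp hug

end TypeSpace

/-! ### Elementary functors, zerosets and their sets of types -/

theorem TFunctor.mem_obj_iff_of_isElementary {X : TFunctor T x} (hX : X.IsElementary) {M N : Model T}
    (f : ElementaryEmbedding M.str N.str) (a : M.str.Tuple x) :
    f.mapTuple a ∈ X.obj N ↔ a ∈ X.obj M := by
  refine ⟨fun h => ?_, X.map_mem f a⟩
  obtain ⟨a', ha', h'⟩ := (hX M N f).subset ⟨h, a, rfl⟩
  exact f.mapTuple_injective h' ▸ ha'

/-- Membership in an elementary functor depends only on the type. -/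
theorem TFunctor.mem_obj_iff_mem_typeSet {X : TFunctor T x} (hX : X.IsElementary) (M : Model T)
    (a : M.str.Tuple x) : a ∈ X.obj M ↔ TypeSpace.of M a ∈ X.typeSet := by
  refine ⟨fun h => ⟨M, a, h, rfl⟩, fun ⟨N, b, hb, h⟩ => ?_⟩
  obtain ⟨K, f, g, hfg⟩ := exists_amalgam (M := M.str) (N := N.str) (a := a) (b := b) fun φ => by
    rw [← TFormula.interp_coe (T := T) φ M a, ← TFormula.interp_coe (T := T) φ N b]
    exact congrFun h _
  let K' : Model T := ⟨K, f.models M.models⟩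
  rw [← mem_obj_iff_of_isElementary hX (N := K') f, hfg]
  exact X.map_mem (N := K') g b hb

/-- The value at `θ` is part of the type, so one realization lies in `X` exactly when all do. -/
theorem TFunctor.typeSet_eq_of_zeroset {X : TFunctor T x} {θ : TFormula T x}
    (hθ : ∀ M : Model T, X.obj M = {a | θ.interp M a = 0}) :
    X.typeSet = (fun p : TypeSpace T x => p.1 θ) ⁻¹' {0} := by
  ext ⟨p, M, a, rfl⟩
  refine ⟨fun ⟨N, b, hb, h⟩ => ?_, fun h => ⟨M, a, (hθ M).superset h, rfl⟩⟩
  exact (congrFun h θ).trans ((hθ N).subset hb)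

theorem TFunctor.isElementary_of_zeroset {X : TFunctor T x} (hX : X.IsZeroset) :
    X.IsElementary := by
  obtain ⟨θ, hθ⟩ := hX
  refine fun M N f => Set.Subset.antisymm ?_ ?_
  · rintro _ ⟨h, a, rfl⟩
    refine ⟨a, (hθ M).superset ?_, rfl⟩
    exact (θ.interp_mapTuple f a).symm.trans ((hθ N).subset h)
  · rintro _ ⟨a, ha, rfl⟩
    exact ⟨X.map_mem f a ha, a, rfl⟩

end ContLanguage

theorem mainTheorem12 (L : ContLanguage.{u}) (T : L.Theory) {n : ℕ} (x : Fin n → L.Sorts)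
    (X : ContLanguage.TFunctor T x) :
    X.IsZeroset ↔ X.IsElementary ∧ IsClosed X.typeSet ∧ IsGδ X.typeSet := by
  constructor
  · refine fun h => ⟨X.isElementary_of_zeroset h, ?_⟩
    obtain ⟨θ, hθ⟩ := h
    rw [X.typeSet_eq_of_zeroset hθ]
    have hc := ContLanguage.TypeSpace.continuous_apply θ
    exact ⟨isClosed_singleton.preimage hc, (isClosed_singleton.isGδ).preimage hc⟩
  · rintro ⟨hX, hcl, hG⟩
    -- The Gδ form of Urysohn's lemma, with empty second set, gives `X.typeSet` as the level set `g
    -- = 1`; hence `θ` is taken to represent `1 - g`.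
    obtain ⟨g, hg, -⟩ := exists_continuous_one_zero_of_isCompact_of_isGδ hcl.isCompact hG
      isClosed_empty (Set.disjoint_empty _)
    obtain ⟨θ, hθ⟩ := ContLanguage.TypeSpace.exists_tformula (1 - g)
    refine ⟨θ, fun M => Set.ext fun a => ?_⟩
    rw [ContLanguage.TFunctor.mem_obj_iff_mem_typeSet hX, hg]
    change g _ = 1 ↔ (ContLanguage.TypeSpace.of M a).1 θ = 0
    rw [hθ, ContinuousMap.sub_apply, ContinuousMap.one_apply, sub_eq_zero, eq_comm]
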